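/- Let $n\ge 1$ and let $B_n$ be the Boolean graph: its vertices are the subsets of $[n]=\{1,\dots,n\}$ other than $\emptyset$ and $[n]$, and $M,N$ are adjacent if and only if $M\cap N=\emptyset$. Let $G$ be either $B_n$ or its complement graph $\overline{B_n}$, and let $\Delta$ be the clique complex of the complement graph $\overline{G}$ (the empty set is a face of every complex). For an integer $s\ge 0$ let $\Delta^{(0,s)}$ be the skeleton consisting of all faces $F$ of $\Delta$ with $|F|\le s+1$, and let $\Delta^{(s,s)}$ be the pure skeleton generated by all faces $F$ of $\Delta$ with $|F|=s+1$ (read as $\{\emptyset\}$ if there are none). Then: (1) For every $s\ge 0$ the complex $\Delta^{(0,s)}$ is vertex decomposable. Here a complex $\Gamma$ is called vertex decomposable if it is a simplex (possibly $\{\emptyset\}$), or if, recursively, it has a vertex $x$ such that both $\Gamma\setminus x=\{F\in\Gamma\mid x\notin F\}$ and $\mathrm{lk}_\Gamma(x)=\{F\in\Gamma\mid x\notin F,\ F\cup\{x\}\in\Gamma\}$ are vertex decomposable and no facet of $\mathrm{lk}_\Gamma(x)$ is a facet of $\Gamma\setminus x$. (2) For every $s\ge 0$ the complex $\Delta^{(s,s)}$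 is pure (all its facets have the same cardinality) and shellable, that is, its facets can be ordered $F_1,\dots,F_t$ so that for all $1\le i<k\le t$ there are $1\le j<k$ and $x\in F_k$ with $F_i\cap F_k\subseteq F_j\cap F_k=F_k\setminus\{x\}$; and it is Cohen–Macaulay over every field $K$, that is, the depth of its Stanley–Reisner ring over $K$ (with respect to the graded maximal ideal) equals the Krull dimension of that ring. -/

import Mathlib

/-- A simplicial complex on vertices taken from `V`: a family of finite subsets of `V` that is
closed under taking subsets and contains the empty face. Points of `V` need not be vertices, so
that deletions, links and pure skeletons are complexes over the same `V`. (Mathlib's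
`PreAbstractSimplicialComplex` leaves out the empty face, which can be a facet here.) -/
@[ext]
structure FaceComplex (V : Type*) where
  faces : Set (Finset V)
  empty_mem : ∅ ∈ faces
  down_closed : ∀ ⦃F G : Finset V⦄, F ∈ faces → G ⊆ F → G ∈ faces

namespace FaceComplex

variable {V : Type*}

/-- A facet is a face that is maximal under inclusion. -/
def IsFacet (Δ : FaceComplex V) (F : Finset V) : Prop :=
  Maximal (fun A => A ∈ Δ.faces) F

/-- The simplex of all subsets of `F`; for `F = ∅` this is `{∅}`. -/
def simplex (F : Finset V) : FaceComplex V where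
  faces := {A | A ⊆ F}
  empty_mem := Finset.empty_subset F
  down_closed := fun _ _ hA hB => hB.trans hA

/-- The subcomplex generated by a family of sets; it is `{∅}` for the empty family. -/
def generate (S : Set (Finset V)) : FaceComplex V where
  faces := {A | A = ∅ ∨ ∃ F ∈ S, A ⊆ F}
  empty_mem := Or.inl rfl
  down_closed := by
    rintro A B (rfl | ⟨F, hF, hAF⟩) hBA
    · exact Or.inl (Finset.subset_empty.mp hBA)
    · exact Or.inr ⟨F, hF, hBA.trans hAF⟩

/-- The deletion `Δ \ x`, the faces that do not contain `x`. -/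
def deletion (Δ : FaceComplex V) (x : V) : FaceComplex V where
  faces := {F | F ∈ Δ.faces ∧ x ∉ F}
  empty_mem := ⟨Δ.empty_mem, Finset.notMem_empty x⟩
  down_closed := fun _ _ hF hG => ⟨Δ.down_closed hF.1 hG, fun h => hF.2 (hG h)⟩

/-- The link of a vertex `x`: the faces `F` with `x ∉ F` and `F ∪ {x} ∈ Δ`. -/
def link [DecidableEq V] (Δ : FaceComplex V) (x : V) (hx : {x} ∈ Δ.faces) : FaceComplex V where
  faces := {F | F ∈ Δ.faces ∧ x ∉ F ∧ insert x F ∈ Δ.faces}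
  empty_mem := ⟨Δ.empty_mem, Finset.notMem_empty x, by simpa using hx⟩
  down_closed := fun _ _ hF hG => ⟨Δ.down_closed hF.1 hG, fun h => hF.2.1 (hG h),
    Δ.down_closed hF.2.2 (Finset.insert_subset_insert x hG)⟩

/-- (Nonpure) vertex decomposability. -/
inductive IsVertexDecomposable [DecidableEq V] : FaceComplex V → Prop
  | simplex (F : Finset V) : IsVertexDecomposable (FaceComplex.simplex F)
  | shed (Δ : FaceComplex V) (x : V) (hx : {x} ∈ Δ.faces)
      (hdel : IsVertexDecomposable (Δ.deletion x))
      (hlink : IsVertexDecomposable (Δ.link x hx))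
      (hshed : ∀ F, (Δ.link x hx).IsFacet F → ¬ (Δ.deletion x).IsFacet F) :
      IsVertexDecomposable Δ

/-- The skeleton `Δ^(0,s)`: all faces with at most `s + 1` elements. -/
def skeleton (Δ : FaceComplex V) (s : ℕ) : FaceComplex V where
  faces := {F | F ∈ Δ.faces ∧ F.card ≤ s + 1}
  empty_mem := ⟨Δ.empty_mem, by simp⟩
  down_closed := fun _ _ hF hG =>
    ⟨Δ.down_closed hF.1 hG, (Finset.card_le_card hG).trans hF.2⟩

/-- The pure skeleton `Δ^(s,s)`: generated by the faces of dimension `s`, that is, those with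
exactly `s + 1` elements. -/
def pureSkeleton (Δ : FaceComplex V) (s : ℕ) : FaceComplex V :=
  generate {F | F ∈ Δ.faces ∧ F.card = s + 1}

/-- All facets have the same dimension. -/
def IsPure (Δ : FaceComplex V) : Prop :=
  ∀ ⦃F G : Finset V⦄, Δ.IsFacet F → Δ.IsFacet G → F.card = G.card

/-- (Nonpure) shellability: the facets can be listed without repetition as `F 0, …, F (t - 1)` so
that for `i < k` there are `j < k` and `x ∈ F k` with `F i ∩ F k ⊆ F j ∩ F k = F k \ {x}`. -/
def IsShellable [DecidableEq V] (Δ : FaceComplex V) : Prop :=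
  ∃ (t : ℕ) (F : Fin t → Finset V), Function.Injective F ∧
    (∀ A, Δ.IsFacet A ↔ ∃ i, F i = A) ∧
    ∀ i k : Fin t, i < k → ∃ j < k, ∃ x ∈ F k,
      F i ∩ F k ⊆ F j ∩ F k ∧ F j ∩ F k = (F k).erase x

section StanleyReisner

variable (k : Type*) [Field k]

/-- The Stanley-Reisner ideal, generated by the squarefree monomials of the non-faces. -/
noncomputable def stanleyReisnerIdeal (Δ : FaceComplex V) : Ideal (MvPolynomial V k) :=
  Ideal.span {m | ∃ F : Finset V, F ∉ Δ.faces ∧ m = ∏ v ∈ F, MvPolynomial.X v}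

/-- The Stanley-Reisner ring `k[Δ]`. -/
abbrev StanleyReisnerRing (Δ : FaceComplex V) : Type _ :=
  MvPolynomial V k ⧸ Δ.stanleyReisnerIdeal k

/-- The graded maximal ideal of `k[Δ]`, generated by the classes of the variables. -/
noncomputable def irrelevantIdeal (Δ : FaceComplex V) : Ideal (Δ.StanleyReisnerRing k) :=
  Ideal.span (Set.range fun v : V =>
    Ideal.Quotient.mk (Δ.stanleyReisnerIdeal k) (MvPolynomial.X v))

/-- The depth of `k[Δ]`: the supremum of the lengths of the regular sequences of `k[Δ]` that are
contained in its graded maximal ideal. -/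
noncomputable def depth (Δ : FaceComplex V) : ℕ∞ :=
  ⨆ (rs : List (Δ.StanleyReisnerRing k))
    (_ : (∀ r ∈ rs, r ∈ Δ.irrelevantIdeal k) ∧
      RingTheory.Sequence.IsRegular (Δ.StanleyReisnerRing k) rs), (rs.length : ℕ∞)

/-- `Δ` is Cohen-Macaulay over `k`: the standard graded algebra `k[Δ]` is Cohen-Macaulay, that is,
its depth equals its Krull dimension. -/
def IsCohenMacaulay (Δ : FaceComplex V) : Prop :=
  (Δ.depth k : WithBot ℕ∞) = ringKrullDim (Δ.StanleyReisnerRing k)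

end StanleyReisner

end FaceComplex

/-- The clique complex of a graph. -/
def cliqueComplex {V : Type*} (H : SimpleGraph V) : FaceComplex V where
  faces := {F | H.IsClique (F : Set V)}
  empty_mem := by simp
  down_closed := fun _ _ hF hG => Set.Pairwise.mono (Finset.coe_subset.mpr hG) hF

/-- The vertices of the Boolean graph: the nonempty proper subsets of an `n`-element set. -/
abbrev BooleanVertex (n : ℕ) : Type :=
  {A : Finset (Fin n) // A ≠ ∅ ∧ A ≠ Finset.univ}

/-- The Boolean graph `B_n`: two vertices are adjacent if and only if they are disjoint. -/
def booleanGraph (n : ℕ) : SimpleGraph (BooleanVertex n) where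
  Adj A B := A.1 ∩ B.1 = ∅
  symm := ⟨fun A B h => by rwa [Finset.inter_comm]⟩
  loopless := ⟨fun A h => A.2.1 (by simpa using h)⟩

/-! In a clique complex a vertex `x` is shedding once some `y` not adjacent to `x` is adjacent to
all neighbours of `x`: then `y` enlarges every face of the link inside the deletion. In `B_n` a set
with at least two elements is dominated in this way by any singleton inside it. In the complement of
`B_n`, among an up-closed family, a minimal member disjoint from another member is dominated by its
set complement. Both situations survive deletion and link, so `Δ` is vertex decomposable
(`isVertexDecomposable_cliquesWithin`).

The rest holds for every vertex decomposable complex. Truncation commutes with deletion and drops by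
one in the link, so skeletons stay vertex decomposable. The faces of size `m + 1` split into those
of the deletion and the cone from `x` over the faces of size `m` of the link, which makes them a
`PureVertexDecomposable` family. Listing the deletion before the cone gives a shelling.

For Cohen–Macaulayness, the elementary symmetric polynomials of degrees `m, …, 1` form a regular
sequence (`weaklyRegularMod_esymmOn`), by induction along `0 → R/(I : x) → R/I → R/(I, x) → 0`. Here
`(I, x)` belongs to the deletion, and `(I : x)` to the link with `x` as a free variable. So the
depth is at least `m`, and the Krull dimension is at most `m`. -/

/-! ### Weakly regular sequences modulo an ideal -/

namespace Ideal

variable {R : Type*} [CommRing R]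

theorem mem_sup_span_singleton_iff_sub {I : Ideal R} {x q : R} :
    q ∈ I ⊔ span {x} ↔ ∃ t, q - x * t ∈ I := by
  rw [sup_comm, mem_span_singleton_sup]
  constructor
  · rintro ⟨t, i, hi, rfl⟩
    exact ⟨t, by convert hi using 1; ring⟩
  · rintro ⟨t, ht⟩
    exact ⟨t, _, ht, by ring⟩

/-- The sequence `rs` is weakly regular modulo the ideal `J`, phrased inside `R`. -/
def WeaklyRegularMod (J : Ideal R) : List R → Prop
  | [] => True
  | r :: rs => (∀ s, r * s ∈ J → s ∈ J) ∧ WeaklyRegularMod (J ⊔ span {r}) rs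

/-- Covers the empty family, whose non-face ideal is the whole ring. -/
theorem weaklyRegularMod_top (rs : List R) : WeaklyRegularMod (⊤ : Ideal R) rs := by
  induction rs with
  | nil => trivial
  | cons r rs ih => exact ⟨fun _ _ => trivial, by simpa using ih⟩

theorem sup_span_singleton_eq_of_sub_mem {J : Ideal R} {r s : R} (h : r - s ∈ J) :
    J ⊔ span {r} = J ⊔ span {s} := by
  apply le_antisymm <;> refine sup_le le_sup_left ((span_singleton_le_iff_mem _).2 ?_)
  · have := add_mem (mem_sup_left (T := span {s}) h) (mem_sup_right (mem_span_singleton_self s))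
    simpa using this
  · have := sub_mem (mem_sup_right (S := J) (mem_span_singleton_self r)) (mem_sup_left h)
    simpa using this

theorem WeaklyRegularMod.congr {rs ss : List R} {J : Ideal R}
    (h : List.Forall₂ (fun r s => r - s ∈ J) rs ss) (hr : J.WeaklyRegularMod rs) :
    J.WeaklyRegularMod ss := by
  induction rs generalizing ss J with
  | nil => cases h; trivial
  | cons r rs ih =>
    cases h with
    | cons h₁ h₂ =>
      refine ⟨fun t ht => hr.1 t ?_, ?_⟩
      · have := add_mem (J.mul_mem_right t h₁) ht
        rwa [sub_mul, sub_add_cancel] at this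
      · rw [← sup_span_singleton_eq_of_sub_mem h₁]
        exact ih (h₂.imp fun _ _ h => mem_sup_left h) hr.2

/-- Weak regularity passes to the middle term of `0 → R/(I : x) → R/I → R/(I, x) → 0`. -/
theorem WeaklyRegularMod.of_colon {x : R} {rs : List R} {I K : Ideal R}
    (hK : ∀ p, x * p ∈ I ↔ p ∈ K) (h₁ : K.WeaklyRegularMod rs)
    (h₂ : (I ⊔ span {x}).WeaklyRegularMod rs) : I.WeaklyRegularMod rs := by
  induction rs generalizing I K with
  | nil => trivial
  | cons r rs ih =>
    -- The exact sequence survives division by `r`: since `r` is regular modulo `(I, x)`, the colon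
    -- ideal of `(I, r)` by `x` is `(K, r)`.
    refine ⟨fun s hs => ?_, ih (K := K ⊔ span {r}) (fun p => ?_) h₁.2 ?_⟩
    · obtain ⟨t, ht⟩ := mem_sup_span_singleton_iff_sub.1 (h₂.1 s (mem_sup_left hs))
      have hxt : x * t ∈ I := by
        refine (hK t).2 (h₁.1 t ((hK _).1 ?_))
        have := sub_mem hs (I.mul_mem_left r ht)
        convert this using 1
        ring
      simpa using add_mem ht hxt
    · rw [mem_sup_span_singleton_iff_sub, mem_sup_span_singleton_iff_sub]
      constructor
      · rintro ⟨u, hu⟩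
        have hru : r * u ∈ I ⊔ span {x} := by
          refine mem_sup_span_singleton_iff_sub.2 ⟨p, ?_⟩
          simpa using neg_mem hu
        obtain ⟨v, hv⟩ := mem_sup_span_singleton_iff_sub.1 (h₂.1 u hru)
        refine ⟨v, (hK _).1 ?_⟩
        convert add_mem hu (I.mul_mem_left r hv) using 1
        ring
      · rintro ⟨v, hv⟩
        refine ⟨x * v, ?_⟩
        convert (hK _).2 hv using 1
        ring
    · rw [sup_right_comm]; exact h₂.2

/-- The list `a m, a (m - 1), …, a 1`. -/
def _root_.List.descending {α : Type*} (a : ℕ → α) : ℕ → List α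
  | 0 => []
  | m + 1 => a (m + 1) :: List.descending a m

theorem _root_.List.forall₂_descending {α β : Type*} {P : α → β → Prop} {a : ℕ → α} {b : ℕ → β}
    (m : ℕ) (h : ∀ i < m, P (a (i + 1)) (b (i + 1))) :
    List.Forall₂ P (List.descending a m) (List.descending b m) := by
  induction m with
  | zero => exact .nil
  | succ m ih => exact .cons (h m m.lt_succ_self) (ih fun i hi => h i (hi.trans m.lt_succ_self))

theorem _root_.List.length_descending {α : Type*} (a : ℕ → α) (m : ℕ) :
    (List.descending a m).length = m := by
  induction m with
  | zero => rfl
  | succ m ih => simp [List.descending, ih]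

theorem _root_.List.exists_of_mem_descending {α : Type*} {a : ℕ → α} {m : ℕ} {r : α}
    (h : r ∈ List.descending a m) : ∃ i, r = a (i + 1) := by
  induction m with
  | zero => simp [List.descending] at h
  | succ m ih =>
    rcases List.mem_cons.1 h with rfl | h
    exacts [⟨m, rfl⟩, ih h]

/-- If `a m, …, a 1` is weakly regular modulo `J` and modulo `(J, x)`, where `x` is regular modulo
`J`, then the coefficients of `(1 + a 1 * t + ⋯ + a m * t ^ m) * (1 + x * t)`, listed downwards,
are weakly regular modulo `J`. -/
theorem WeaklyRegularMod.mul_linear {a b : ℕ → R} {x : R} (ha : a 0 = 1)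
    (hb : ∀ i, b (i + 1) = a (i + 1) + x * a i) (m : ℕ) {J : Ideal R}
    (hx : ∀ p, x * p ∈ J → p ∈ J) (h₁ : J.WeaklyRegularMod (List.descending a m))
    (h₂ : (J ⊔ span {x}).WeaklyRegularMod (List.descending a m)) :
    J.WeaklyRegularMod (x * a m :: List.descending b m) := by
  induction m generalizing J with
  | zero =>
    refine ⟨fun s hs => hx s ?_, trivial⟩
    simpa [ha] using hs
  | succ m ih =>
    refine ⟨fun s hs => h₁.1 s (hx _ (by rwa [← mul_assoc])), ?_⟩
    have hcolon : ∀ p, x * p ∈ J ⊔ span {x * a (m + 1)} ↔ p ∈ J ⊔ span {a (m + 1)} := by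
      intro p
      rw [mem_sup_span_singleton_iff_sub, mem_sup_span_singleton_iff_sub]
      refine exists_congr fun t => ⟨fun h => hx _ ?_, fun h => ?_⟩
      · convert h using 1; ring
      · convert J.mul_mem_left x h using 1; ring
    -- Modulo the colon ideal `(J, a (m + 1))` the leading entry `b (m + 1)` is congruent to `x * a
    -- m`, which is the induction hypothesis; modulo `(J, x)` each `b i` is congruent to `a i`.
    refine WeaklyRegularMod.of_colon hcolon ?_ ?_
    · have key : (J ⊔ span {a (m + 1)}).WeaklyRegularMod (x * a m :: List.descending b m) := by
        -- Swapping two regular elements: `x` stays regular modulo `(J, a (m + 1))` because `a (m +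
        -- 1)` is regular modulo `(J, x)`.
        refine ih (fun p hp => ?_) h₁.2 (by rw [sup_right_comm]; exact h₂.2)
        obtain ⟨t, ht⟩ := mem_sup_span_singleton_iff_sub.1 hp
        have hat : a (m + 1) * t ∈ J ⊔ span {x} :=
          mem_sup_span_singleton_iff_sub.2 ⟨p, by simpa using neg_mem ht⟩
        obtain ⟨u, hu⟩ := mem_sup_span_singleton_iff_sub.1 (h₂.1 t hat)
        refine mem_sup_span_singleton_iff_sub.2 ⟨u, hx _ ?_⟩
        convert add_mem ht (J.mul_mem_left (a (m + 1)) hu) using 1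
        ring
      refine key.congr (.cons ?_ (List.forall₂_same.2 fun r _ => by simp))
      rw [hb]
      refine mem_sup_right (mem_span_singleton.2 ⟨-1, by ring⟩)
    · have hsup : J ⊔ span {x * a (m + 1)} ⊔ span {x} = J ⊔ span {x} := by
        rw [sup_assoc, sup_eq_right.2 ((span_singleton_le_span_singleton (x := x * a (m + 1))).2
          (Dvd.intro _ rfl))]
      rw [hsup]
      refine h₂.congr (List.forall₂_descending _ fun i _ => ?_)
      rw [hb]
      exact mem_sup_right (mem_span_singleton.2 ⟨-a i, by ring⟩)

open scoped Pointwise in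
/-- Comparison with Mathlib's weakly regular sequences. -/
theorem isWeaklyRegular_quotient_iff {J : Ideal R} {rs : List R} :
    RingTheory.Sequence.IsWeaklyRegular (R ⧸ J) rs ↔ J.WeaklyRegularMod rs := by
  induction rs generalizing J with
  | nil => exact ⟨fun _ => trivial, fun _ => .nil _ _⟩
  | cons r rs ih =>
    rw [RingTheory.Sequence.isWeaklyRegular_cons_iff]
    refine and_congr ?_ ?_
    · rw [isSMulRegular_iff_right_eq_zero_of_smul]
      constructor
      · intro h s hs
        refine Quotient.eq_zero_iff_mem.1 (h (Quotient.mk J s) ?_)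
        rw [← Quotient.eq_zero_iff_mem] at hs
        exact hs
      · intro h s
        obtain ⟨s, rfl⟩ := Quotient.mk_surjective s
        intro hs
        refine Quotient.eq_zero_iff_mem.2 (h s (Quotient.eq_zero_iff_mem.1 hs))
    · rw [← ih]
      refine LinearEquiv.isWeaklyRegular_congr ?_ rs
      refine ?_ ≪≫ₗ Submodule.quotientQuotientEquivQuotientSup (J : Submodule R R) (span {r})
      refine Submodule.quotEquivOfEq _ _ ?_
      have hr : span {r} = r • (⊤ : Submodule R R) := by
        rw [← Submodule.ideal_span_singleton_smul]
        exact (Ideal.mul_top _).symm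
      rw [hr, Submodule.map_pointwise_smul, Submodule.map_top, Submodule.range_mkQ]

/-- The length of a weakly regular sequence modulo `J` generating a proper ideal with `J` is bounded
by the Krull dimension. -/
theorem WeaklyRegularMod.length_le_ringKrullDim {J : Ideal R} {rs : List R}
    (h : J.WeaklyRegularMod rs) (hne : J ⊔ Ideal.ofList rs ≠ ⊤) :
    (rs.length : WithBot ℕ∞) ≤ ringKrullDim (R ⧸ J) := by
  induction rs generalizing J with
  | nil =>
    have : Nontrivial (R ⧸ J) := Quotient.nontrivial_iff.2 (by simpa using hne)
    simpa using ringKrullDim_nonneg_of_nontrivial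
  | cons r rs ih =>
    have h' := ih h.2 (by rwa [sup_assoc, ← Ideal.ofList_cons])
    refine le_trans ?_ (ringKrullDim_succ_le_of_surjective
      (Quotient.factor (S := J) (T := J ⊔ span {r}) le_sup_left)
      (Quotient.factor_surjective le_sup_left) (r := Quotient.mk J r) ?_ ?_)
    · push_cast [List.length_cons]
      gcongr
    · rw [mem_nonZeroDivisors_iff_right]
      intro s hs
      obtain ⟨s, rfl⟩ := Quotient.mk_surjective s
      rw [← map_mul, Quotient.eq_zero_iff_mem, mul_comm] at hs
      exact Quotient.eq_zero_iff_mem.2 (h.1 s hs)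
    · rw [Quotient.factor_mk, Quotient.eq_zero_iff_mem]
      exact mem_sup_right (mem_span_singleton_self r)

end Ideal

/-! ### Pure vertex decomposable families -/

/-- Pure vertex decomposability of the complex generated by a family of sets of size `m`: the family
is empty or `{∅}`, or all its members contain a common `x` whose link is again such a family, or
there is a shedding vertex `x` with deletion `𝓓` and link `𝓛`. -/
inductive PureVertexDecomposable {V : Type*} [DecidableEq V] : ℕ → Set (Finset V) → Prop
  | empty (m : ℕ) : PureVertexDecomposable m ∅
  | zero : PureVertexDecomposable 0 {∅}
  | cone {m : ℕ} {x : V} {𝓛 : Set (Finset V)} (hx : ∀ A ∈ 𝓛, x ∉ A)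
      (hlink : PureVertexDecomposable m 𝓛) : PureVertexDecomposable (m + 1) (insert x '' 𝓛)
  | shed {m : ℕ} {x : V} {𝓓 𝓛 : Set (Finset V)} (hxD : ∀ A ∈ 𝓓, x ∉ A) (hxL : ∀ A ∈ 𝓛, x ∉ A)
      (hdel : PureVertexDecomposable (m + 1) 𝓓) (hlink : PureVertexDecomposable m 𝓛)
      (hshed : ∀ A ∈ 𝓛, ∃ B ∈ 𝓓, A ⊆ B) :
      PureVertexDecomposable (m + 1) (𝓓 ∪ insert x '' 𝓛)

namespace PureVertexDecomposable

variable {V : Type*} [DecidableEq V] {m : ℕ} {𝓕 : Set (Finset V)}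

theorem card_eq (h : PureVertexDecomposable m 𝓕) : ∀ A ∈ 𝓕, A.card = m := by
  induction h with
  | empty => simp
  | zero => simp
  | cone hx _ ih =>
    rintro _ ⟨A, hA, rfl⟩
    rw [Finset.card_insert_of_notMem (hx A hA), ih A hA]
  | shed _ hxL _ _ _ ihD ihL =>
    rintro _ (hA | ⟨A, hA, rfl⟩)
    · exact ihD _ hA
    · rw [Finset.card_insert_of_notMem (hxL A hA), ihL A hA]

end PureVertexDecomposable

/-! ### Skeletons of vertex decomposable complexes -/

namespace FaceComplex

variable {V : Type*}

/-- The faces with at most `m` elements. -/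
def truncate (Δ : FaceComplex V) (m : ℕ) : FaceComplex V where
  faces := {F | F ∈ Δ.faces ∧ F.card ≤ m}
  empty_mem := ⟨Δ.empty_mem, by simp⟩
  down_closed := fun _ _ hF hG => ⟨Δ.down_closed hF.1 hG, (Finset.card_le_card hG).trans hF.2⟩

theorem truncate_zero (Δ : FaceComplex V) : Δ.truncate 0 = simplex ∅ := by
  ext A
  simp only [truncate, simplex, Set.mem_ofPred_eq, Nat.le_zero, Finset.card_eq_zero,
    Finset.subset_empty]
  exact ⟨fun h => h.2, fun h => ⟨h ▸ Δ.empty_mem, h⟩⟩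

theorem truncate_simplex_of_card_le {F : Finset V} {m : ℕ} (h : F.card ≤ m) :
    (simplex F).truncate m = simplex F := by
  ext A
  exact ⟨fun hA => hA.1, fun hA => ⟨hA, (Finset.card_le_card hA).trans h⟩⟩

theorem deletion_truncate (Δ : FaceComplex V) (x : V) (m : ℕ) :
    (Δ.truncate m).deletion x = (Δ.deletion x).truncate m := by
  ext A
  simp only [truncate, deletion, Set.mem_ofPred_eq]
  tauto

/-- The faces with exactly `m` elements. -/
def facesOfCard (Δ : FaceComplex V) (m : ℕ) : Set (Finset V) := {F | F ∈ Δ.faces ∧ F.card = m}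

theorem facesOfCard_zero (Δ : FaceComplex V) : Δ.facesOfCard 0 = {∅} := by
  ext A
  simp only [facesOfCard, Finset.card_eq_zero, Set.mem_ofPred_eq, Set.mem_singleton_iff]
  exact ⟨fun h => h.2, fun h => ⟨h ▸ Δ.empty_mem, h⟩⟩

theorem isFacet_generate_iff {m : ℕ} {𝓕 : Set (Finset V)} (hcard : ∀ A ∈ 𝓕, A.card = m)
    (hne : 𝓕.Nonempty) {A : Finset V} : (generate 𝓕).IsFacet A ↔ A ∈ 𝓕 := by
  have hsub : ∀ B ∈ (generate 𝓕).faces, ∃ C ∈ 𝓕, B ⊆ C := by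
    rintro B (rfl | hB)
    · exact hne.imp fun C hC => ⟨hC, by simp⟩
    · exact hB
  constructor
  · intro hA
    obtain ⟨C, hC, hAC⟩ := hsub A hA.1
    rwa [hAC.antisymm (hA.2 (Or.inr ⟨C, hC, subset_rfl⟩) hAC)]
  · refine fun hA => ⟨Or.inr ⟨A, hA, subset_rfl⟩, fun B hB hAB => ?_⟩
    obtain ⟨C, hC, hBC⟩ := hsub B hB
    have : A = C := Finset.eq_of_subset_of_card_le (hAB.trans hBC) (by rw [hcard A hA, hcard C hC])
    exact this ▸ hBC

variable [DecidableEq V]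

theorem link_truncate (Δ : FaceComplex V) {x : V} {m : ℕ} (hx : {x} ∈ Δ.faces)
    (hx' : {x} ∈ (Δ.truncate (m + 1)).faces) :
    (Δ.truncate (m + 1)).link x hx' = (Δ.link x hx).truncate m := by
  ext A
  simp only [truncate, link, Set.mem_ofPred_eq]
  constructor
  · rintro ⟨⟨h₁, _⟩, h₂, h₃, h₄⟩
    rw [Finset.card_insert_of_notMem h₂] at h₄
    exact ⟨⟨h₁, h₂, h₃⟩, by omega⟩
  · rintro ⟨⟨h₁, h₂, h₃⟩, h₄⟩
    refine ⟨⟨h₁, by omega⟩, h₂, h₃, ?_⟩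
    rw [Finset.card_insert_of_notMem h₂]
    omega

theorem deletion_simplex_insert {x : V} {F : Finset V} (hx : x ∉ F) :
    (simplex (insert x F)).deletion x = simplex F := by
  ext A
  simp only [deletion, simplex, Set.mem_ofPred_eq]
  constructor
  · rintro ⟨h, hxA⟩
    exact (Finset.subset_insert_iff_of_notMem hxA).1 h
  · exact fun h => ⟨h.trans (Finset.subset_insert x F), fun hA => hx (h hA)⟩

theorem link_simplex_insert {x : V} {F : Finset V} (hx : x ∉ F)
    (hx' : {x} ∈ (simplex (insert x F)).faces) :
    (simplex (insert x F)).link x hx' = simplex F := by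
  ext A
  simp only [link, simplex, Set.mem_ofPred_eq]
  constructor
  · rintro ⟨h, hxA, _⟩
    exact (Finset.subset_insert_iff_of_notMem hxA).1 h
  · exact fun h => ⟨h.trans (Finset.subset_insert x F), fun hA => hx (h hA),
      Finset.insert_subset_insert x h⟩

/-- A face of the link of a shedding vertex can be enlarged in the deletion. -/
theorem exists_insert_mem_of_shed {Δ : FaceComplex V} {x : V} {hx : {x} ∈ Δ.faces}
    (hshed : ∀ F, (Δ.link x hx).IsFacet F → ¬ (Δ.deletion x).IsFacet F) {A : Finset V}
    (hA : A ∈ (Δ.link x hx).faces) : ∃ y ∉ A, insert y A ∈ (Δ.deletion x).faces := by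
  by_contra! hcon
  have hdel : (Δ.deletion x).IsFacet A := by
    refine ⟨⟨hA.1, hA.2.1⟩, fun B hB hAB y hy => ?_⟩
    by_contra hyA
    exact hcon y hyA ((Δ.deletion x).down_closed hB (Finset.insert_subset hy hAB))
  exact hshed A ⟨hA, fun B hB hAB => hdel.2 ⟨hB.1, hB.2.1⟩ hAB⟩ hdel

theorem not_isFacet_of_insert_mem {Δ : FaceComplex V} {A : Finset V} {y : V} (hy : y ∉ A)
    (h : insert y A ∈ Δ.faces) : ¬ Δ.IsFacet A :=
  fun hA => hy (hA.2 h (Finset.subset_insert y A) (Finset.mem_insert_self y A))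

/-- A proper skeleton of a simplex is no simplex, so this base case needs its own induction. Any
vertex is shedding: a face of the truncated link is smaller than `F` and can be enlarged inside `F`.
-/
theorem truncate_simplex_isVertexDecomposable (F : Finset V) (m : ℕ) :
    ((simplex F).truncate m).IsVertexDecomposable := by
  induction F using Finset.induction_on generalizing m with
  | empty =>
    rw [truncate_simplex_of_card_le (by simp)]
    exact .simplex _
  | insert x F hxF ih =>
    cases m with
    | zero => rw [truncate_zero]; exact .simplex _
    | succ m =>
      by_cases hm : (insert x F).card ≤ m + 1
      · rw [truncate_simplex_of_card_le hm]
        exact .simplex _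
      have hx : {x} ∈ (simplex (insert x F)).faces := by simp [simplex]
      have hx' : {x} ∈ ((simplex (insert x F)).truncate (m + 1)).faces := ⟨hx, by simp⟩
      refine .shed _ x hx' ?_ ?_ fun A hA => ?_
      · rw [deletion_truncate, deletion_simplex_insert hxF]
        exact ih _
      · rw [link_truncate _ hx, link_simplex_insert hxF]
        exact ih _
      · rw [link_truncate _ hx, link_simplex_insert hxF] at hA
        rw [deletion_truncate, deletion_simplex_insert hxF]
        rw [Finset.card_insert_of_notMem hxF] at hm
        have hAm : A.card ≤ m := hA.1.2
        obtain ⟨y, hyF, hyA⟩ := Finset.exists_mem_notMem_of_card_lt_card (s := A) (t := F) (by omega)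
        refine not_isFacet_of_insert_mem hyA ⟨Finset.insert_subset hyF hA.1.1, ?_⟩
        rw [Finset.card_insert_of_notMem hyA]
        omega

/-- The same vertex sheds: a face of the truncated link has at most `m` elements, so its one-point
enlargement in the deletion survives truncation at `m + 1`. -/
theorem IsVertexDecomposable.truncate {Δ : FaceComplex V} (h : Δ.IsVertexDecomposable) (m : ℕ) :
    (Δ.truncate m).IsVertexDecomposable := by
  induction h generalizing m with
  | simplex F => exact truncate_simplex_isVertexDecomposable F m
  | shed Δ x hx _ _ hshed ihD ihL =>
    cases m with
    | zero => rw [truncate_zero]; exact .simplex _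
    | succ m =>
      have hx' : {x} ∈ (Δ.truncate (m + 1)).faces := ⟨hx, by simp⟩
      refine .shed _ x hx' ?_ ?_ fun A hA => ?_
      · rw [deletion_truncate]; exact ihD _
      · rw [link_truncate _ hx]; exact ihL _
      · rw [link_truncate _ hx] at hA
        rw [deletion_truncate]
        obtain ⟨y, hy, hyA⟩ := exists_insert_mem_of_shed hshed hA.1.1
        refine not_isFacet_of_insert_mem hy ⟨hyA, ?_⟩
        rw [Finset.card_insert_of_notMem hy]
        have := hA.1.2
        omega

theorem facesOfCard_succ (Δ : FaceComplex V) {x : V} (hx : {x} ∈ Δ.faces) (m : ℕ) :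
    Δ.facesOfCard (m + 1) =
      (Δ.deletion x).facesOfCard (m + 1) ∪ insert x '' (Δ.link x hx).facesOfCard m := by
  ext A
  constructor
  · rintro ⟨hA, hc⟩
    by_cases hxA : x ∈ A
    · refine Or.inr ⟨A.erase x, ⟨⟨Δ.down_closed hA (A.erase_subset x), A.notMem_erase x, ?_⟩, ?_⟩,
        Finset.insert_erase hxA⟩
      · rwa [Finset.insert_erase hxA]
      · rw [Finset.card_erase_of_mem hxA, hc]; rfl
    · exact Or.inl ⟨⟨hA, hxA⟩, hc⟩
  · rintro (⟨⟨hA, _⟩, hc⟩ | ⟨B, ⟨⟨_, hxB, hB⟩, hc⟩, rfl⟩)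
    · exact ⟨hA, hc⟩
    · exact ⟨hB, by rw [Finset.card_insert_of_notMem hxB, hc]⟩

theorem pureVertexDecomposable_facesOfCard_simplex (F : Finset V) (m : ℕ) :
    PureVertexDecomposable m ((simplex F).facesOfCard m) := by
  induction F using Finset.induction_on generalizing m with
  | empty =>
    cases m with
    | zero => rw [facesOfCard_zero]; exact .zero
    | succ m =>
      convert PureVertexDecomposable.empty (V := V) (m + 1)
      rw [Set.eq_empty_iff_forall_notMem]
      rintro A ⟨hA, hc⟩
      rw [Finset.subset_empty.1 hA] at hc
      simp at hc
  | insert x F hxF ih =>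
    cases m with
    | zero => rw [facesOfCard_zero]; exact .zero
    | succ m =>
      have hx : {x} ∈ (simplex (insert x F)).faces := by simp [simplex]
      rw [facesOfCard_succ _ hx, deletion_simplex_insert hxF, link_simplex_insert hxF]
      have hxF' : ∀ m, ∀ A ∈ (simplex F).facesOfCard m, x ∉ A := fun m A hA h => hxF (hA.1 h)
      by_cases hm : m < F.card
      · refine .shed (hxF' _) (hxF' _) (ih _) (ih _) fun A hA => ?_
        have hAm : A.card = m := hA.2
        obtain ⟨y, hyF, hyA⟩ := Finset.exists_mem_notMem_of_card_lt_card (s := A) (t := F) (by omega)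
        exact ⟨insert y A, ⟨Finset.insert_subset hyF hA.1,
          by rw [Finset.card_insert_of_notMem hyA, hAm]⟩, Finset.subset_insert y A⟩
      -- `F` is too small for faces of size `m + 1`, so all of them contain `x`; this is where the
      -- `cone` constructor is needed.
      · have : (simplex F).facesOfCard (m + 1) = ∅ := by
          rw [Set.eq_empty_iff_forall_notMem]
          rintro A ⟨hA, hc⟩
          have := Finset.card_le_card hA
          omega
        rw [this, Set.empty_union]
        exact .cone (hxF' _) (ih _)

theorem IsVertexDecomposable.pureVertexDecomposable {Δ : FaceComplex V}
    (h : Δ.IsVertexDecomposable) (m : ℕ) : PureVertexDecomposable m (Δ.facesOfCard m) := by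
  induction h generalizing m with
  | simplex F => exact pureVertexDecomposable_facesOfCard_simplex F m
  | shed Δ x hx _ _ hshed ihD ihL =>
    cases m with
    | zero => rw [facesOfCard_zero]; exact .zero
    | succ m =>
      rw [facesOfCard_succ _ hx]
      refine .shed (fun A hA => hA.1.2) (fun A hA => hA.1.2.1) (ihD _) (ihL _) fun A hA => ?_
      obtain ⟨y, hy, hyA⟩ := exists_insert_mem_of_shed hshed hA.1
      exact ⟨insert y A, ⟨hyA, by rw [Finset.card_insert_of_notMem hy, hA.2]⟩,
        Finset.subset_insert y A⟩

/-- A pure skeleton of a vertex decomposable complex is generated by a nonempty pure vertex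
decomposable family. -/
theorem IsVertexDecomposable.exists_pureSkeleton_eq_generate {Δ : FaceComplex V}
    (h : Δ.IsVertexDecomposable) (s : ℕ) : ∃ (m : ℕ) (𝓕 : Set (Finset V)),
      PureVertexDecomposable m 𝓕 ∧ 𝓕.Nonempty ∧ Δ.pureSkeleton s = generate 𝓕 := by
  rcases (Δ.facesOfCard (s + 1)).eq_empty_or_nonempty with h0 | hne
  -- Without faces of size `s + 1` the pure skeleton is `{∅}`, generated by a family of sets of size
  -- `0`.
  · refine ⟨0, {∅}, .zero, by simp, ?_⟩
    change generate (Δ.facesOfCard (s + 1)) = _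
    rw [h0]
    ext A
    simp [generate]
  · exact ⟨s + 1, _, h.pureVertexDecomposable (s + 1), hne, rfl⟩

theorem isPure_generate {m : ℕ} {𝓕 : Set (Finset V)} (h : PureVertexDecomposable m 𝓕)
    (hne : 𝓕.Nonempty) : (generate 𝓕).IsPure := by
  intro A B hA hB
  rw [isFacet_generate_iff h.card_eq hne] at hA hB
  rw [h.card_eq A hA, h.card_eq B hB]

/-! ### Shellability -/

/-- A list of sets which is a shelling when read from its end. -/
def IsReverseShelling : List (Finset V) → Prop
  | [] => True
  | B :: l => (∀ A ∈ l, ∃ C ∈ l, ∃ x ∈ B, A ∩ B ⊆ C ∩ B ∧ C ∩ B = B.erase x) ∧ IsReverseShelling l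

/-- Read from the end, `d` comes first. A set `insert x B` meets each member of `d` inside `B`, and
meets a member of `d` containing `B` exactly in `B`, that is, in itself without `x`. The case `d =
[]` serves cones. -/
theorem IsReverseShelling.map_insert_append {x : V} {l d : List (Finset V)}
    (hl : IsReverseShelling l) (hd : IsReverseShelling d) (hxl : ∀ A ∈ l, x ∉ A)
    (hxd : ∀ A ∈ d, x ∉ A) (h : d = [] ∨ ∀ A ∈ l, ∃ B ∈ d, A ⊆ B) :
    IsReverseShelling (l.map (insert x) ++ d) := by
  induction l with
  | nil => exact hd
  | cons B l ih =>
    have hxB : x ∉ B := hxl B (by simp)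
    refine ⟨fun A hA => ?_, ih hl.2 (fun A hA => hxl A (by simp [hA]))
      (h.imp_right fun h A hA => h A (by simp [hA]))⟩
    rcases List.mem_append.1 hA with hA | hA
    · obtain ⟨A, hAl, rfl⟩ := List.mem_map.1 hA
      obtain ⟨C, hC, y, hy, h₁, h₂⟩ := hl.1 A hAl
      have hyx : y ≠ x := fun h => hxB (h ▸ hy)
      refine ⟨insert x C, List.mem_append_left _ (List.mem_map_of_mem hC), y, by simp [hy], ?_, ?_⟩
      · rw [← Finset.insert_inter_distrib, ← Finset.insert_inter_distrib]
        exact Finset.insert_subset_insert x h₁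
      · rw [← Finset.insert_inter_distrib, h₂, Finset.erase_insert_of_ne hyx.symm]
    · rcases h with rfl | h
      · simp at hA
      obtain ⟨C, hC, hBC⟩ := h B (by simp)
      have hCB : C ∩ insert x B = B := by
        rw [Finset.inter_insert_of_notMem (hxd C hC), Finset.inter_eq_right.2 hBC]
      refine ⟨C, List.mem_append_right _ hC, x, by simp, ?_, ?_⟩
      · rw [hCB, Finset.inter_insert_of_notMem (hxd A hA)]
        exact Finset.inter_subset_right
      · rw [hCB, Finset.erase_insert hxB]

theorem _root_.PureVertexDecomposable.exists_isReverseShelling {m : ℕ} {𝓕 : Set (Finset V)}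
    (h : PureVertexDecomposable m 𝓕) :
    ∃ l : List (Finset V), l.Nodup ∧ (∀ A, A ∈ l ↔ A ∈ 𝓕) ∧ IsReverseShelling l := by
  have hinj : ∀ {x : V} {l : List (Finset V)}, l.Nodup → (∀ A ∈ l, x ∉ A) →
      (l.map (insert x)).Nodup := by
    intro x l hl hx
    refine List.Nodup.map_on (fun A hA B hB hAB => ?_) hl
    rw [← Finset.erase_insert (hx A hA), hAB, Finset.erase_insert (hx B hB)]
  induction h with
  | empty => exact ⟨[], by simp, by simp, trivial⟩
  | zero => exact ⟨[∅], by simp, by simp, by simp [IsReverseShelling]⟩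
  | @cone m x 𝓛 hx _ ih =>
    obtain ⟨l, hnd, hmem, hl⟩ := ih
    have hxl : ∀ A ∈ l, x ∉ A := fun A hA => hx A ((hmem A).1 hA)
    refine ⟨l.map (insert x), hinj hnd hxl, by simp [hmem], ?_⟩
    simpa using hl.map_insert_append (d := []) trivial hxl (by simp) (.inl rfl)
  | @shed m x 𝓓 𝓛 hxD hxL _ _ hshed ihD ihL =>
    obtain ⟨l, hnd, hmem, hl⟩ := ihL
    obtain ⟨d, hndd, hmemd, hd⟩ := ihD
    have hxl : ∀ A ∈ l, x ∉ A := fun A hA => hxL A ((hmem A).1 hA)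
    have hxd : ∀ A ∈ d, x ∉ A := fun A hA => hxD A ((hmemd A).1 hA)
    refine ⟨l.map (insert x) ++ d, ?_, ?_, ?_⟩
    · refine List.nodup_append'.2 ⟨hinj hnd hxl, hndd, fun A hA hA' => ?_⟩
      obtain ⟨B, _, rfl⟩ := List.mem_map.1 hA
      exact hxd _ hA' (Finset.mem_insert_self x B)
    · intro A
      simp [hmem, hmemd, or_comm]
    · refine hl.map_insert_append hd hxl hxd (.inr fun A hA => ?_)
      obtain ⟨B, hB, hAB⟩ := hshed A ((hmem A).1 hA)
      exact ⟨B, (hmemd B).2 hB, hAB⟩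

theorem IsReverseShelling.exists_getElem {l : List (Finset V)} (hl : IsReverseShelling l)
    {i k : ℕ} (hki : k < i) (hi : i < l.length) :
    ∃ (j : ℕ) (hj : j < l.length), k < j ∧ ∃ x ∈ l[k],
      l[i] ∩ l[k] ⊆ l[j] ∩ l[k] ∧ l[j] ∩ l[k] = l[k].erase x := by
  induction l generalizing i k with
  | nil => simp at hi
  | cons B l ih =>
    obtain ⟨i, rfl⟩ : ∃ i', i = i' + 1 := ⟨i - 1, by omega⟩
    have hi' : i < l.length := by simpa using hi
    cases k with
    | zero =>
      obtain ⟨C, hC, x, hx, h⟩ := hl.1 l[i] (List.getElem_mem hi')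
      obtain ⟨j, hj, rfl⟩ := List.getElem_of_mem hC
      exact ⟨j + 1, by simpa using hj, by omega, x, hx, h⟩
    | succ k =>
      obtain ⟨j, hj, hkj, x, hx, h⟩ := ih hl.2 (k := k) (by omega) hi'
      exact ⟨j + 1, by simpa using hj, by omega, x, hx, h⟩

theorem isShellable_generate {m : ℕ} {𝓕 : Set (Finset V)} (h : PureVertexDecomposable m 𝓕)
    (hne : 𝓕.Nonempty) : (generate 𝓕).IsShellable := by
  obtain ⟨l, hnd, hmem, hl⟩ := h.exists_isReverseShelling
  refine ⟨l.length, fun i => l.get i.rev, ?_, fun A => ?_, fun i k hik => ?_⟩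
  · exact (List.nodup_iff_injective_get.1 hnd).comp Fin.rev_injective
  · rw [isFacet_generate_iff h.card_eq hne, ← hmem, List.mem_iff_get]
    exact ⟨fun ⟨i, hi⟩ => ⟨i.rev, by simpa using hi⟩, fun ⟨i, hi⟩ => ⟨i.rev, hi⟩⟩
  · obtain ⟨j, hj, hkj, x, hx, h⟩ := hl.exists_getElem (Fin.rev_lt_rev.2 hik) i.rev.2
    refine ⟨Fin.rev ⟨j, hj⟩, ?_, x, hx, by simpa using h⟩
    rw [← Fin.rev_lt_rev, Fin.rev_rev]
    exact hkj

end FaceComplex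

/-! ### Stanley–Reisner rings, depth and dimension -/

namespace FaceComplex

open MvPolynomial

variable {V : Type*} (k : Type*) [Field k]

/-- The ideal generated by the squarefree monomials on `T` whose support lies in no member of `𝓕`;
the variables outside `T` are free. -/
noncomputable def nonfaceIdeal (T : Finset V) (𝓕 : Set (Finset V)) : Ideal (MvPolynomial V k) :=
  Ideal.span {p | ∃ F : Finset V, (F ⊆ T ∧ ∀ A ∈ 𝓕, ¬ F ⊆ A) ∧ p = ∏ v ∈ F, X v}

/-- The elementary symmetric polynomials in the variables of `T`. -/
noncomputable def esymmOn (T : Finset V) (i : ℕ) : MvPolynomial V k :=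
  ∑ A ∈ T.powersetCard i, ∏ v ∈ A, X v

variable {k}

theorem prod_X_mem_nonfaceIdeal {T F : Finset V} {𝓕 : Set (Finset V)} (hF : F ⊆ T)
    (h : ∀ A ∈ 𝓕, ¬ F ⊆ A) : ∏ v ∈ F, (X v : MvPolynomial V k) ∈ nonfaceIdeal k T 𝓕 :=
  Ideal.subset_span ⟨F, ⟨hF, h⟩, rfl⟩

theorem X_mem_nonfaceIdeal {T : Finset V} {x : V} {𝓕 : Set (Finset V)} (hx : x ∈ T)
    (h : ∀ A ∈ 𝓕, x ∉ A) : (X x : MvPolynomial V k) ∈ nonfaceIdeal k T 𝓕 := by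
  simpa using prod_X_mem_nonfaceIdeal (k := k) (F := {x}) (by simpa using hx) (by simpa using h)

theorem nonfaceIdeal_le {T : Finset V} {𝓕 : Set (Finset V)} {I : Ideal (MvPolynomial V k)}
    (h : ∀ F ⊆ T, (∀ A ∈ 𝓕, ¬ F ⊆ A) → ∏ v ∈ F, X v ∈ I) : nonfaceIdeal k T 𝓕 ≤ I := by
  refine Ideal.span_le.2 ?_
  rintro _ ⟨F, ⟨hFT, hF⟩, rfl⟩
  exact h F hFT hF

theorem prod_X_mem_span_X {F : Finset V} {x : V} (hx : x ∈ F) :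
    ∏ v ∈ F, (X v : MvPolynomial V k) ∈ Ideal.span {X x} :=
  Ideal.mem_span_singleton.2 (Finset.dvd_prod_of_mem _ hx)

theorem nonfaceIdeal_empty (T : Finset V) : nonfaceIdeal k T ∅ = ⊤ := by
  rw [Ideal.eq_top_iff_one]
  simpa using prod_X_mem_nonfaceIdeal (k := k) (F := ∅) (T := T) (𝓕 := ∅) (by simp) (by simp)

theorem esymmOn_mem_nonfaceIdeal {T : Finset V} {𝓕 : Set (Finset V)} {m : ℕ}
    (hcard : ∀ A ∈ 𝓕, A.card = m) : esymmOn k T (m + 1) ∈ nonfaceIdeal k T 𝓕 := by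
  refine Ideal.sum_mem _ fun A hA => ?_
  obtain ⟨hAT, hc⟩ := Finset.mem_powersetCard.1 hA
  refine prod_X_mem_nonfaceIdeal hAT fun B hB hAB => ?_
  have := Finset.card_le_card hAB
  rw [hcard B hB] at this
  omega

theorem esymmOn_zero (T : Finset V) : esymmOn k T 0 = 1 := by
  simp [esymmOn]

/-- Nonemptiness matters: `generate ∅` still has the empty face, while the ideal of the empty family
is the whole ring. -/
theorem stanleyReisnerIdeal_generate [Fintype V] {𝓕 : Set (Finset V)} (hne : 𝓕.Nonempty) :
    (generate 𝓕).stanleyReisnerIdeal k = nonfaceIdeal k Finset.univ 𝓕 := by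
  rw [stanleyReisnerIdeal, nonfaceIdeal]
  congr 1
  ext p
  refine exists_congr fun F => and_congr_left fun _ => ?_
  have : F ∈ (generate 𝓕).faces ↔ ∃ A ∈ 𝓕, F ⊆ A := by
    refine ⟨?_, .inr⟩
    rintro (rfl | h)
    · exact hne.imp fun A hA => ⟨hA, by simp⟩
    · exact h
  simp [this]

/-- The irrelevant ideal of a Stanley-Reisner ring is proper. -/
theorem irrelevantIdeal_ne_top (Δ : FaceComplex V) : Δ.irrelevantIdeal k ≠ ⊤ := by
  have hle : Δ.stanleyReisnerIdeal k ≤ RingHom.ker (constantCoeff (σ := V) (R := k)) := by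
    refine Ideal.span_le.2 ?_
    rintro _ ⟨F, hF, rfl⟩
    have hne : F.Nonempty := Finset.nonempty_iff_ne_empty.2 fun h => hF (h ▸ Δ.empty_mem)
    simp [RingHom.mem_ker, map_prod, Finset.prod_const, hne.ne_empty]
  have hker : Δ.irrelevantIdeal k ≤
      RingHom.ker (Ideal.Quotient.lift (Δ.stanleyReisnerIdeal k) constantCoeff hle) := by
    refine Ideal.span_le.2 ?_
    rintro _ ⟨v, rfl⟩
    exact (Ideal.Quotient.lift_mk _ _ _).trans (constantCoeff_X _ v)
  intro h
  exact RingHom.ker_ne_top _ (top_le_iff.1 (h ▸ hker))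

theorem depth_le_ringKrullDim (Δ : FaceComplex V) :
    (Δ.depth k : WithBot ℕ∞) ≤ ringKrullDim (Δ.StanleyReisnerRing k) := by
  have hlen : ∀ rs : List (Δ.StanleyReisnerRing k), (∀ r ∈ rs, r ∈ Δ.irrelevantIdeal k) ∧
      RingTheory.Sequence.IsRegular (Δ.StanleyReisnerRing k) rs →
      ((rs.length : ℕ∞) : WithBot ℕ∞) ≤ ringKrullDim (Δ.StanleyReisnerRing k) := by
    rintro rs ⟨hmem, hreg⟩
    have hw : (⊥ : Ideal (Δ.StanleyReisnerRing k)).WeaklyRegularMod rs :=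
      Ideal.isWeaklyRegular_quotient_iff.1
        (((Submodule.quotEquivOfEqBot _ rfl).isWeaklyRegular_congr rs).2 hreg.1)
    have hle : Ideal.ofList rs ≤ Δ.irrelevantIdeal k := Ideal.span_le.2 hmem
    have := hw.length_le_ringKrullDim fun h => irrelevantIdeal_ne_top (k := k) Δ
      (top_le_iff.1 (by simpa [← h] using hle))
    rw [ringKrullDim_eq_of_ringEquiv (RingEquiv.quotientBot _)] at this
    exact_mod_cast this
  have : Nontrivial (Δ.StanleyReisnerRing k) :=
    ⟨0, 1, fun h => irrelevantIdeal_ne_top (k := k) Δ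
      ((Ideal.eq_top_iff_one _).2 (h ▸ Ideal.zero_mem _))⟩
  -- This excludes the value `⊥`, so that the supremum can be compared within `ℕ∞`.
  have h0 : (0 : WithBot ℕ∞) ≤ ringKrullDim (Δ.StanleyReisnerRing k) :=
    ringKrullDim_nonneg_of_nontrivial
  revert hlen h0
  generalize ringKrullDim (Δ.StanleyReisnerRing k) = d
  intro hlen h0
  induction d with
  | bot => simp at h0
  | coe d =>
    rw [WithBot.coe_le_coe]
    exact iSup₂_le fun rs hrs => WithBot.coe_le_coe.1 (hlen rs hrs)

/-- Let `P` be the smallest prime of a chain. The variables outside `P` form a face, as the product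
over a non-face lies in `P`. So the quotient by `P` is an image of a polynomial ring in at most `m`
variables, and the whole chain lives above `P`. -/
theorem ringKrullDim_stanleyReisnerRing_le [Finite V] (Δ : FaceComplex V) {m : ℕ}
    (hcard : ∀ F ∈ Δ.faces, F.card ≤ m) :
    ringKrullDim (Δ.StanleyReisnerRing k) ≤ m := by
  classical
  cases nonempty_fintype V
  rw [ringKrullDim_quotient]
  refine iSup_le fun c => ?_
  set P := c.head.1 with hP
  set F : Finset V := Finset.univ.filter fun v => (X v : MvPolynomial V k) ∉ P.asIdeal with hFdef
  have hF : F ∈ Δ.faces := by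
    by_contra hF
    have hmem : ∏ v ∈ F, (X v : MvPolynomial V k) ∈ P.asIdeal :=
      c.head.2 (Ideal.subset_span ⟨F, hF, rfl⟩)
    obtain ⟨v, hv, hvP⟩ := (P.2.prod_mem_iff).1 hmem
    exact (Finset.mem_filter.1 hv).2 hvP
  have hdim : ringKrullDim (MvPolynomial V k ⧸ P.asIdeal) ≤ m := by
    let f : MvPolynomial F k →ₐ[k] MvPolynomial V k ⧸ P.asIdeal :=
      aeval fun v => Ideal.Quotient.mk _ (X v.1)
    have hf : Function.Surjective f := by
      have hrange : ∀ p : MvPolynomial V k, Ideal.Quotient.mkₐ k P.asIdeal p ∈ f.range := by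
        intro p
        induction p using MvPolynomial.induction_on with
        | C a => exact ⟨C a, by simp [f]⟩
        | add p q hp hq => rw [map_add]; exact add_mem hp hq
        | mul_X p v hp =>
          rw [map_mul]
          refine mul_mem hp ?_
          by_cases hv : v ∈ F
          · exact ⟨X ⟨v, hv⟩, by simp [f]⟩
          · have : Ideal.Quotient.mkₐ k P.asIdeal (X v) = 0 :=
              Ideal.Quotient.eq_zero_iff_mem.2 (by simpa [hFdef] using hv)
            rw [this]
            exact zero_mem _
      intro q
      obtain ⟨p, rfl⟩ := Ideal.Quotient.mk_surjective q
      exact hrange p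
    refine (ringKrullDim_le_of_surjective f.toRingHom hf).trans ?_
    rw [MvPolynomial.ringKrullDim_of_isNoetherianRing, ringKrullDim_eq_zero_of_field, zero_add]
    simpa using hcard F hF
  rw [ringKrullDim_quotient] at hdim
  refine le_trans ?_ hdim
  let c' : LTSeries (PrimeSpectrum.zeroLocus (R := MvPolynomial V k) P.asIdeal) :=
    { length := c.length
      toFun := fun i => ⟨(c i).1, (c.head_le i : c.head ≤ c i)⟩
      step := fun i => c.step i }
  exact le_iSup (fun c : LTSeries (PrimeSpectrum.zeroLocus (R := MvPolynomial V k) P.asIdeal) =>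
    ((c.length : ℕ∞) : WithBot ℕ∞)) c'

variable [DecidableEq V]

/-- The generators are squarefree monomials, so membership is tested on the support of each
monomial. This turns the colon computations below into combinatorics. -/
theorem mem_nonfaceIdeal {T : Finset V} {𝓕 : Set (Finset V)} {p : MvPolynomial V k} :
    p ∈ nonfaceIdeal k T 𝓕 ↔ ∀ u ∈ p.support, ∀ A ∈ 𝓕, ¬ u.support ∩ T ⊆ A := by
  have hset : {p : MvPolynomial V k | ∃ F : Finset V, (F ⊆ T ∧ ∀ A ∈ 𝓕, ¬ F ⊆ A) ∧
      p = ∏ v ∈ F, X v} = (fun u => monomial u (1 : k)) ''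
        ((fun F : Finset V => ∑ v ∈ F, Finsupp.single v 1) '' {F | F ⊆ T ∧ ∀ A ∈ 𝓕, ¬ F ⊆ A}) := by
    ext p
    simp only [Set.mem_image, exists_exists_and_eq_and, Set.mem_ofPred_eq]
    refine exists_congr fun F => and_congr_right fun _ => ?_
    rw [monomial_sum_one, eq_comm]
    rfl
  have hval : ∀ (F : Finset V) (v : V),
      (∑ w ∈ F, Finsupp.single w 1 : V →₀ ℕ) v = if v ∈ F then 1 else 0 := by
    intro F v
    simp [Finsupp.finsetSum_apply, Finsupp.single_apply]
  rw [nonfaceIdeal, hset, mem_ideal_span_monomial_image]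
  refine forall₂_congr fun u _ => ?_
  constructor
  · rintro ⟨_, ⟨F, ⟨hFT, hF⟩, rfl⟩, hFu⟩ A hA hu
    refine hF A hA (subset_trans (fun v hv => ?_) hu)
    have := hFu v
    rw [hval, if_pos hv] at this
    exact Finset.mem_inter.2 ⟨Finsupp.mem_support_iff.2 (by omega), hFT hv⟩
  · refine fun h => ⟨_, ⟨u.support ∩ T, ⟨Finset.inter_subset_right, h⟩, rfl⟩, fun v => ?_⟩
    rw [hval]
    split_ifs with hv
    · exact Nat.one_le_iff_ne_zero.2 (Finsupp.mem_support_iff.1 (Finset.mem_inter.1 hv).1)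
    · exact Nat.zero_le _

/-- By the shedding condition, a face avoiding `x` already lies in a member of `𝓓`. -/
theorem nonfaceIdeal_sup_span_X {T : Finset V} {x : V} {𝓓 𝓛 : Set (Finset V)} (hx : x ∈ T)
    (hxD : ∀ A ∈ 𝓓, x ∉ A) (hshed : ∀ A ∈ 𝓛, ∃ B ∈ 𝓓, A ⊆ B) :
    nonfaceIdeal k T (𝓓 ∪ insert x '' 𝓛) ⊔ Ideal.span {X x} = nonfaceIdeal k T 𝓓 := by
  apply le_antisymm
  · refine sup_le (nonfaceIdeal_le fun F hF h => ?_)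
      ((Ideal.span_singleton_le_iff_mem _).2 (X_mem_nonfaceIdeal hx hxD))
    exact prod_X_mem_nonfaceIdeal hF fun A hA => h A (.inl hA)
  · refine nonfaceIdeal_le fun F hF h => ?_
    by_cases hxF : x ∈ F
    · exact Ideal.mem_sup_right (prod_X_mem_span_X hxF)
    · refine Ideal.mem_sup_left (prod_X_mem_nonfaceIdeal hF ?_)
      rintro _ (hA | ⟨A, hA, rfl⟩)
      · exact h _ hA
      · intro hFA
        obtain ⟨B, hB, hAB⟩ := hshed A hA
        exact h B hB (((Finset.subset_insert_iff_of_notMem hxF).1 hFA).trans hAB)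

theorem nonfaceIdeal_erase_sup_span_X {T : Finset V} {x : V} {𝓛 : Set (Finset V)} (hx : x ∈ T)
    (hxL : ∀ A ∈ 𝓛, x ∉ A) :
    nonfaceIdeal k (T.erase x) 𝓛 ⊔ Ideal.span {X x} = nonfaceIdeal k T 𝓛 := by
  apply le_antisymm
  · refine sup_le (nonfaceIdeal_le fun F hF h => ?_)
      ((Ideal.span_singleton_le_iff_mem _).2 (X_mem_nonfaceIdeal hx hxL))
    exact prod_X_mem_nonfaceIdeal (hF.trans (T.erase_subset x)) h
  · refine nonfaceIdeal_le fun F hF h => ?_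
    by_cases hxF : x ∈ F
    · exact Ideal.mem_sup_right (prod_X_mem_span_X hxF)
    · exact Ideal.mem_sup_left (prod_X_mem_nonfaceIdeal (Finset.subset_erase.2 ⟨hF, hxF⟩) h)

/-- Multiplying by `X x` puts `x` into every support, so only the members `insert x A` can contain
it. -/
theorem X_mul_mem_nonfaceIdeal_iff {T : Finset V} {x : V} {𝓓 𝓛 : Set (Finset V)} (hx : x ∈ T)
    (hxD : ∀ A ∈ 𝓓, x ∉ A) (p : MvPolynomial V k) :
    X x * p ∈ nonfaceIdeal k T (𝓓 ∪ insert x '' 𝓛) ↔ p ∈ nonfaceIdeal k (T.erase x) 𝓛 := by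
  rw [mem_nonfaceIdeal, mem_nonfaceIdeal, support_X_mul]
  simp only [Finset.forall_mem_map]
  refine forall₂_congr fun u _ => ?_
  have hu : (Finsupp.single x 1 + u).support ∩ T = insert x (u.support ∩ T.erase x) := by
    ext v
    by_cases hv : v = x
    · subst hv; simp [hx]
    · simp [hv]
  have hxu : x ∉ u.support ∩ T.erase x := by simp
  simp only [addLeftEmbedding_apply, hu]
  constructor
  · intro h A hA hsub
    exact h _ (.inr ⟨A, hA, rfl⟩) (Finset.insert_subset_insert x hsub)
  · rintro h _ (hA | ⟨A, hA, rfl⟩) hsub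
    · exact hxD _ hA (hsub (Finset.mem_insert_self _ _))
    · exact h A hA ((Finset.insert_subset_insert_iff hxu).1 hsub)

theorem X_mul_mem_nonfaceIdeal_erase {T : Finset V} {x : V} {𝓛 : Set (Finset V)}
    (p : MvPolynomial V k) (h : X x * p ∈ nonfaceIdeal k (T.erase x) 𝓛) :
    p ∈ nonfaceIdeal k (T.erase x) 𝓛 := by
  rw [mem_nonfaceIdeal, support_X_mul] at h
  rw [mem_nonfaceIdeal]
  simp only [Finset.forall_mem_map] at h
  intro u hu
  have hsupp : (addLeftEmbedding (Finsupp.single x 1) u).support ∩ T.erase x =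
      u.support ∩ T.erase x := by
    ext v
    by_cases hv : v = x <;> simp [hv]
  exact hsupp ▸ h u hu

/-- Every member contains `x`, so `x` cannot affect whether a set is a face. -/
theorem nonfaceIdeal_image_insert {T : Finset V} {x : V} {𝓛 : Set (Finset V)} :
    nonfaceIdeal k T (insert x '' 𝓛) = nonfaceIdeal k (T.erase x) 𝓛 := by
  ext p
  simp only [mem_nonfaceIdeal, Set.forall_mem_image]
  refine forall₂_congr fun u _ => forall₂_congr fun A _ => not_congr ?_
  rw [Finset.subset_insert_iff, ← Finset.inter_erase]

/-- Take the factor `1 + X x * t` out of the product of all `1 + X v * t`; this is the shape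
required by `mul_linear`. -/
theorem esymmOn_succ {T : Finset V} {x : V} (hx : x ∈ T) (i : ℕ) :
    esymmOn k T (i + 1) = esymmOn k (T.erase x) (i + 1) + X x * esymmOn k (T.erase x) i := by
  have hxT := T.notMem_erase x
  rw [esymmOn, ← Finset.insert_erase hx, Finset.powersetCard_succ_insert hxT,
    Finset.sum_union, Finset.sum_image, Finset.insert_erase hx, esymmOn, esymmOn, Finset.mul_sum]
  · refine congrArg₂ _ rfl (Finset.sum_congr rfl fun A hA => ?_)
    rw [Finset.prod_insert fun h => hxT ((Finset.mem_powersetCard.1 hA).1 h)]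
  · intro A hA B hB hAB
    rw [← Finset.erase_insert fun h => hxT ((Finset.mem_powersetCard.1 hA).1 h), hAB,
      Finset.erase_insert fun h => hxT ((Finset.mem_powersetCard.1 hB).1 h)]
  · refine Finset.disjoint_left.2 fun A hA hA' => ?_
    obtain ⟨B, _, rfl⟩ := Finset.mem_image.1 hA'
    exact hxT ((Finset.mem_powersetCard.1 hA).1 (Finset.mem_insert_self x B))

/-- The cone step for weak regularity of the elementary symmetric polynomials. -/
theorem weaklyRegularMod_esymmOn_of_link {T : Finset V} {x : V} {𝓛 : Set (Finset V)} {m : ℕ}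
    (hx : x ∈ T) (hxL : ∀ A ∈ 𝓛, x ∉ A) (hcard : ∀ A ∈ 𝓛, A.card = m)
    (h₁ : (nonfaceIdeal k (T.erase x) 𝓛).WeaklyRegularMod
      (List.descending (esymmOn k (T.erase x)) m))
    (h₂ : (nonfaceIdeal k T 𝓛).WeaklyRegularMod (List.descending (esymmOn k T) m)) :
    (nonfaceIdeal k (T.erase x) 𝓛).WeaklyRegularMod (List.descending (esymmOn k T) (m + 1)) := by
  have h := Ideal.WeaklyRegularMod.mul_linear (x := (X x : MvPolynomial V k))
    (esymmOn_zero (T.erase x)) (esymmOn_succ hx) m X_mul_mem_nonfaceIdeal_erase h₁ ?_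
  -- The leading entry `X x * esymmOn k (T.erase x) m` may replace degree `m + 1` on `T`: the
  -- difference has too large supports to be nonzero modulo the ideal.
  · refine h.congr (.cons ?_ (List.forall₂_same.2 fun r _ => by simp))
    rw [esymmOn_succ hx]
    simpa using esymmOn_mem_nonfaceIdeal hcard
  · rw [nonfaceIdeal_erase_sup_span_X hx hxL]
    refine h₂.congr (List.forall₂_descending _ fun i _ => ?_)
    rw [esymmOn_succ hx, add_sub_cancel_left]
    exact Ideal.mul_mem_right _ _ (X_mem_nonfaceIdeal hx hxL)

/-- On a pure vertex decomposable family of `m`-sets the elementary symmetric polynomials of degrees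
`m, …, 1` form a weakly regular sequence. -/
theorem weaklyRegularMod_esymmOn {m : ℕ} {𝓕 : Set (Finset V)} (h : PureVertexDecomposable m 𝓕)
    {T : Finset V} (hT : ∀ A ∈ 𝓕, A ⊆ T) :
    (nonfaceIdeal k T 𝓕).WeaklyRegularMod (List.descending (esymmOn k T) m) := by
  induction h generalizing T with
  | empty =>
    rw [nonfaceIdeal_empty]
    exact Ideal.weaklyRegularMod_top _
  | zero => trivial
  | @cone m x 𝓛 hxL hlink ih =>
    rcases 𝓛.eq_empty_or_nonempty with rfl | ⟨A, hA⟩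
    · rw [Set.image_empty, nonfaceIdeal_empty]
      exact Ideal.weaklyRegularMod_top _
    have hx : x ∈ T := hT _ ⟨A, hA, rfl⟩ (Finset.mem_insert_self x A)
    have hT' : ∀ A ∈ 𝓛, A ⊆ T := fun A hA => (Finset.subset_insert x A).trans (hT _ ⟨A, hA, rfl⟩)
    rw [nonfaceIdeal_image_insert]
    exact weaklyRegularMod_esymmOn_of_link hx hxL hlink.card_eq
      (ih fun A hA => Finset.subset_erase.2 ⟨hT' A hA, hxL A hA⟩) (ih hT')
  | @shed m x 𝓓 𝓛 hxD hxL _ hlink hshed ihD ih =>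
    have hTD : ∀ A ∈ 𝓓, A ⊆ T := fun A hA => hT A (.inl hA)
    -- If the link is empty, nothing forces `x` to lie in `T`.
    rcases 𝓛.eq_empty_or_nonempty with rfl | ⟨A, hA⟩
    · rw [Set.image_empty, Set.union_empty]
      exact ihD hTD
    have hx : x ∈ T := hT _ (.inr ⟨A, hA, rfl⟩) (Finset.mem_insert_self x A)
    have hT' : ∀ A ∈ 𝓛, A ⊆ T := fun A hA =>
      (Finset.subset_insert x A).trans (hT _ (.inr ⟨A, hA, rfl⟩))
    refine Ideal.WeaklyRegularMod.of_colon (X_mul_mem_nonfaceIdeal_iff hx hxD) ?_ ?_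
    · exact weaklyRegularMod_esymmOn_of_link hx hxL hlink.card_eq
        (ih fun A hA => Finset.subset_erase.2 ⟨hT' A hA, hxL A hA⟩) (ih hT')
    · rw [nonfaceIdeal_sup_span_X hx hxD hshed]
      exact ihD hTD

theorem le_depth_generate [Finite V] {m : ℕ} {𝓕 : Set (Finset V)}
    (h : PureVertexDecomposable m 𝓕) (hne : 𝓕.Nonempty) : (m : ℕ∞) ≤ (generate 𝓕).depth k := by
  cases nonempty_fintype V
  set Δ := generate 𝓕
  have hw := weaklyRegularMod_esymmOn (k := k) h (T := Finset.univ) fun A _ => A.subset_univ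
  rw [← stanleyReisnerIdeal_generate hne, ← Ideal.isWeaklyRegular_quotient_iff,
    ← RingTheory.Sequence.isWeaklyRegular_map_algebraMap_iff (Δ.StanleyReisnerRing k)] at hw
  set rs := (List.descending (esymmOn k Finset.univ) m).map
    (algebraMap (MvPolynomial V k) (Δ.StanleyReisnerRing k)) with hrs
  have hmem : ∀ r ∈ rs, r ∈ Δ.irrelevantIdeal k := by
    intro r hr
    obtain ⟨e, he, rfl⟩ := List.mem_map.1 hr
    -- The degree `i + 1` is positive, so each monomial contains a variable.
    obtain ⟨i, rfl⟩ := List.exists_of_mem_descending he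
    rw [esymmOn, map_sum]
    refine Ideal.sum_mem _ fun A hA => ?_
    have hA' : A.Nonempty := Finset.card_pos.1 (by rw [(Finset.mem_powersetCard.1 hA).2]; omega)
    obtain ⟨v, hv⟩ := hA'
    rw [map_prod]
    exact Ideal.mem_of_dvd _ (Finset.dvd_prod_of_mem _ hv) (Ideal.subset_span ⟨v, rfl⟩)
  have hlen : rs.length = m := by rw [hrs, List.length_map, List.length_descending]
  rw [← hlen]
  refine le_iSup₂_of_le rs ⟨hmem, hw, fun htop => ?_⟩ le_rfl
  refine irrelevantIdeal_ne_top (k := k) Δ (top_le_iff.1 ?_)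
  rw [htop]
  exact Submodule.smul_le.2 fun r hr s _ =>
    Ideal.mul_mem_right s _ ((Ideal.span_le (I := Δ.irrelevantIdeal k)).2 hmem hr)

theorem isCohenMacaulay_generate [Finite V] {m : ℕ} {𝓕 : Set (Finset V)}
    (h : PureVertexDecomposable m 𝓕) (hne : 𝓕.Nonempty) : (generate 𝓕).IsCohenMacaulay k := by
  refine le_antisymm (depth_le_ringKrullDim _)
    ((ringKrullDim_stanleyReisnerRing_le _ (m := m) ?_).trans ?_)
  · rintro F (rfl | ⟨A, hA, hFA⟩)
    · simp
    · exact (Finset.card_le_card hFA).trans (h.card_eq A hA).le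
  · exact_mod_cast WithBot.coe_le_coe.2 (le_depth_generate (k := k) h hne)

end FaceComplex

/-! ### Vertex decomposable clique complexes -/

namespace FaceComplex

variable {V : Type*}

/-- The cliques of `H` inside `U`. -/
def cliquesWithin (H : SimpleGraph V) (U : Finset V) : FaceComplex V where
  faces := {F | F ⊆ U ∧ H.IsClique (F : Set V)}
  empty_mem := by simp
  down_closed := fun _ _ hF hG =>
    ⟨hG.trans hF.1, Set.Pairwise.mono (Finset.coe_subset.mpr hG) hF.2⟩

theorem cliquesWithin_univ [Fintype V] (H : SimpleGraph V) :
    cliquesWithin H Finset.univ = cliqueComplex H := by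
  ext F
  simp [cliquesWithin, cliqueComplex]

variable [DecidableEq V]

/-- A vertex `x` of a clique complex is shedding when some vertex `y` not adjacent to `x` is adjacent
to all neighbours of `x`. If a class of vertex sets always offers such a vertex, and is stable under
deletion and link, its clique complexes are vertex decomposable. -/
theorem isVertexDecomposable_cliquesWithin (H : SimpleGraph V) [DecidableRel H.Adj]
    (P : Finset V → Prop)
    (step : ∀ U, P U → H.IsClique (U : Set V) ∨ ∃ x ∈ U, ∃ y ∈ U, x ≠ y ∧ ¬ H.Adj x y ∧
      (∀ z ∈ U, H.Adj x z → H.Adj y z) ∧ P (U.erase x) ∧ P (U.filter (H.Adj x)))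
    (U : Finset V) (hU : P U) : (cliquesWithin H U).IsVertexDecomposable := by
  induction U using Finset.strongInduction with
  | H U ih =>
    rcases step U hU with hcl | ⟨x, hxU, y, hyU, hxy, hnadj, hdom, hdel, hlink⟩
    · have : cliquesWithin H U = simplex U := by
        ext F
        exact ⟨fun h => h.1, fun h => ⟨h, hcl.subset (Finset.coe_subset.2 h)⟩⟩
      rw [this]
      exact .simplex U
    · have hx : {x} ∈ (cliquesWithin H U).faces := ⟨by simpa using hxU, by simp⟩
      have hdel' : (cliquesWithin H U).deletion x = cliquesWithin H (U.erase x) := by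
        ext F
        simp only [deletion, cliquesWithin, Set.mem_ofPred_eq, Finset.subset_erase]
        tauto
      have hlink' : (cliquesWithin H U).link x hx = cliquesWithin H (U.filter (H.Adj x)) := by
        ext F
        constructor
        · rintro ⟨⟨hFU, hF⟩, hxF, _, hins⟩
          refine ⟨fun v hv => Finset.mem_filter.2 ⟨hFU hv, hins (by simp) (by simp [hv]) ?_⟩, hF⟩
          rintro rfl
          exact hxF hv
        · rintro ⟨hFU, hF⟩
          have hadj : ∀ v ∈ F, H.Adj x v := fun v hv => (Finset.mem_filter.1 (hFU hv)).2
          have hFU' : F ⊆ U := hFU.trans (Finset.filter_subset _ _)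
          refine ⟨⟨hFU', hF⟩, fun h => (hadj x h).ne rfl, Finset.insert_subset hxU hFU', ?_⟩
          rw [Finset.coe_insert, SimpleGraph.isClique_insert]
          exact ⟨hF, fun v hv _ => hadj v hv⟩
      refine .shed _ x hx ?_ ?_ fun F hF => ?_
      · rw [hdel']
        exact ih _ (Finset.erase_ssubset hxU) hdel
      · rw [hlink']
        exact ih _ (Finset.filter_ssubset.2 ⟨x, hxU, H.loopless.irrefl x⟩) hlink
      · rw [hlink'] at hF
        rw [hdel']
        obtain ⟨hFU, hFc⟩ := hF.1
        have hadj : ∀ v ∈ F, H.Adj x v := fun v hv => (Finset.mem_filter.1 (hFU hv)).2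
        have hFU' : F ⊆ U := hFU.trans (Finset.filter_subset _ _)
        -- All of `F` is adjacent to `x`, hence to `y`, whereas `y` is not adjacent to `x`; so `y`
        -- is a new vertex enlarging `F`.
        refine not_isFacet_of_insert_mem (y := y) (fun h => hnadj (hadj y h)) ⟨?_, ?_⟩
        · refine Finset.insert_subset (Finset.mem_erase.2 ⟨hxy.symm, hyU⟩)
            (Finset.subset_erase.2 ⟨hFU', fun h => (hadj x h).ne rfl⟩)
        · rw [Finset.coe_insert, SimpleGraph.isClique_insert]
          exact ⟨hFc, fun v hv _ => hdom v (hFU' hv) (hadj v hv)⟩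

end FaceComplex

/-! ### The Boolean graph and its complement -/

open FaceComplex

/-- Invariant: `U` contains the singletons of all elements of its members. A member with at least
two elements is dominated by a singleton inside it; once only singletons remain, they are pairwise
disjoint. Only non-singletons are deleted, and singletons inside a set disjoint from `A` are
disjoint from `A`. -/
theorem isVertexDecomposable_cliqueComplex_booleanGraph (n : ℕ) :
    (cliqueComplex (booleanGraph n)).IsVertexDecomposable := by
  classical
  rw [← cliquesWithin_univ]
  refine isVertexDecomposable_cliquesWithin (booleanGraph n)
    (fun U => ∀ A ∈ U, ∀ i ∈ A.1, ∃ B ∈ U, B.1 = {i}) (fun U hU => ?_) _ fun A _ i hi => ?_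
  · by_cases hsing : ∀ A ∈ U, A.1.card ≤ 1
    · left
      intro A hA B hB hAB
      by_contra hint
      obtain ⟨i, hi⟩ := Finset.nonempty_iff_ne_empty.2 hint
      rw [Finset.mem_inter] at hi
      refine hAB (Subtype.ext ?_)
      rw [Finset.eq_singleton_iff_unique_mem.2 ⟨hi.1, fun j hj =>
          Finset.card_le_one.1 (hsing A hA) j hj i hi.1⟩,
        Finset.eq_singleton_iff_unique_mem.2 ⟨hi.2, fun j hj =>
          Finset.card_le_one.1 (hsing B hB) j hj i hi.2⟩]
    · right
      push Not at hsing
      obtain ⟨A, hA, hcard⟩ := hsing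
      obtain ⟨i, hi⟩ := Finset.nonempty_iff_ne_empty.2 A.2.1
      obtain ⟨B, hB, hBi⟩ := hU A hA i hi
      refine ⟨A, hA, B, hB, ?_, ?_, fun C _ hC => ?_, fun C hC j hj => ?_, fun C hC j hj => ?_⟩
      · rintro rfl
        simp [hBi] at hcard
      · intro h
        have : i ∈ A.1 ∩ B.1 := by simp [hi, hBi]
        rw [show A.1 ∩ B.1 = ∅ from h] at this
        simp at this
      · change B.1 ∩ C.1 = ∅
        have hAC : A.1 ∩ C.1 = ∅ := hC
        refine Finset.subset_empty.1 ((Finset.inter_subset_inter_right ?_).trans hAC.subset)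
        simpa [hBi] using hi
      · obtain ⟨D, hD, hDj⟩ := hU C (Finset.mem_of_mem_erase hC) j hj
        refine ⟨D, Finset.mem_erase.2 ⟨?_, hD⟩, hDj⟩
        rintro rfl
        simp [hDj] at hcard
      · obtain ⟨hCU, hAC⟩ := Finset.mem_filter.1 hC
        obtain ⟨D, hD, hDj⟩ := hU C hCU j hj
        refine ⟨D, Finset.mem_filter.2 ⟨hD, ?_⟩, hDj⟩
        change A.1 ∩ D.1 = ∅
        have hAC' : A.1 ∩ C.1 = ∅ := hAC
        refine Finset.subset_empty.1 ((Finset.inter_subset_inter_left ?_).trans hAC'.subset)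
        simpa [hDj] using hj
  · refine ⟨⟨{i}, by simp, fun h => A.2.2 ?_⟩, Finset.mem_univ _, rfl⟩
    refine Finset.univ_subset_iff.1 (h.symm.subset.trans ?_)
    simpa using hi

/-- Invariant: `U` is up-closed. Given disjoint members `A` and `B`, let `M` be minimal in `U` below
`A`; its complement contains `B`, so it lies in `U`. By minimality a member other than `M` is not
inside `M`, so it meets the complement of `M`. -/
theorem isVertexDecomposable_cliqueComplex_booleanGraph_compl (n : ℕ) :
    (cliqueComplex (booleanGraph n)ᶜ).IsVertexDecomposable := by
  classical
  have hadj : ∀ A B : BooleanVertex n, (booleanGraph n)ᶜ.Adj A B ↔ A ≠ B ∧ ¬ Disjoint A.1 B.1 := by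
    intro A B
    rw [SimpleGraph.compl_adj, Finset.disjoint_iff_inter_eq_empty]
    rfl
  rw [← cliquesWithin_univ]
  refine isVertexDecomposable_cliquesWithin (booleanGraph n)ᶜ
    (fun U => ∀ A ∈ U, ∀ B, A ≤ B → B ∈ U) (fun U hU => ?_) _ fun _ _ _ _ => Finset.mem_univ _
  by_cases hpair : ∀ A ∈ U, ∀ B ∈ U, ¬ Disjoint A.1 B.1
  · exact .inl fun A hA B hB hAB => (hadj A B).2 ⟨hAB, hpair A hA B hB⟩
  right
  push Not at hpair
  obtain ⟨A, hA, B, hB, hAB⟩ := hpair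
  obtain ⟨M, hMA, hM⟩ := U.exists_le_minimal hA
  have hmin : ∀ C ∈ U, C ≤ M → C = M := fun C hC hCM => le_antisymm hCM (hM.2 hC hCM)
  have hMB : Disjoint M.1 B.1 := hAB.mono_left hMA
  let N : BooleanVertex n := ⟨M.1ᶜ, fun h => M.2.2 (by simpa using h),
    fun h => M.2.1 (by simpa using h)⟩
  have hBN : B ≤ N := show B.1 ≤ M.1ᶜ from le_compl_iff_disjoint_left.2 hMB
  have hMN : Disjoint M.1 N.1 := disjoint_compl_right
  have hne : M ≠ N := by
    intro h
    rw [← h, disjoint_self] at hMN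
    exact M.2.1 hMN
  refine ⟨M, hM.1, N, hU B hB N hBN, hne, fun h => ((hadj _ _).1 h).2 hMN, fun C hC hMC => ?_,
    fun C hC D hCD => ?_, fun C hC D hCD => ?_⟩
  · obtain ⟨hMC, hdis⟩ := (hadj _ _).1 hMC
    refine (hadj _ _).2 ⟨?_, fun h => hMC (hmin C hC ?_).symm⟩
    · rintro rfl
      exact hdis hMN
    · exact show C.1 ≤ M.1 by simpa [N] using disjoint_compl_left_iff.1 h
  · obtain ⟨hCM, hCU⟩ := Finset.mem_erase.1 hC
    refine Finset.mem_erase.2 ⟨?_, hU C hCU D hCD⟩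
    rintro rfl
    exact hCM (hmin C hCU hCD)
  -- The neighbours of `M` are up-closed: a superset `D` of `C` still meets `M`, and `D = M` would
  -- force `C = M`.
  · obtain ⟨hCU, hMC⟩ := Finset.mem_filter.1 hC
    obtain ⟨hne, hdis⟩ := (hadj _ _).1 hMC
    refine Finset.mem_filter.2 ⟨hU C hCU D hCD, (hadj _ _).2 ⟨?_, fun h => hdis (h.mono_right hCD)⟩⟩
    rintro rfl
    exact hne (hmin C hCU hCD).symm

theorem mainTheorem4 (n : ℕ) (hn : 1 ≤ n) (G : SimpleGraph (BooleanVertex n))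
    (hG : G = booleanGraph n ∨ G = (booleanGraph n)ᶜ) :
    (∀ s : ℕ, ((cliqueComplex Gᶜ).skeleton s).IsVertexDecomposable) ∧
    (∀ s : ℕ, ((cliqueComplex Gᶜ).pureSkeleton s).IsPure ∧
      ((cliqueComplex Gᶜ).pureSkeleton s).IsShellable ∧
      ∀ (k : Type*) [Field k], ((cliqueComplex Gᶜ).pureSkeleton s).IsCohenMacaulay k) := by
  have hvd : (cliqueComplex Gᶜ).IsVertexDecomposable := by
    rcases hG with rfl | rfl
    · exact isVertexDecomposable_cliqueComplex_booleanGraph_compl n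
    · rw [compl_compl]
      exact isVertexDecomposable_cliqueComplex_booleanGraph n
  -- By definition, `skeleton s` is the truncation at `s + 1` elements.
  refine ⟨fun s => hvd.truncate (s + 1), fun s => ?_⟩
  obtain ⟨m, 𝓕, h𝓕, hne, heq⟩ := hvd.exists_pureSkeleton_eq_generate s
  rw [heq]
  exact ⟨isPure_generate h𝓕 hne, isShellable_generate h𝓕 hne,
    fun k _ => isCohenMacaulay_generate h𝓕 hne⟩
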